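/- Let $u_0 = 1_{[0,1)}$. **Slopes.** Set $\alpha_0 := 1$, $\beta_0 := -\infty$ and, for $n \ge 0$, $\frac1{\alpha_{n+1}} := \frac1{\alpha_n} + 1$ (so $\alpha_n = \frac1{n+1}$), $$\beta^*_{n+1} := \begin{cases} \bigl(\tfrac1{\beta_n}+1\bigr)^{-1} & \text{if } \beta_n \ne -1,-\infty,\\ 1 & \text{if } \beta_n = -\infty,\\ -\infty & \text{if } \beta_n = -1,\end{cases} \qquad \beta_{n+1} := \begin{cases}\beta^*_{n+1} & \text{if } \beta^*_{n+1}\le 0,\\ \alpha_{n+1}+\alpha_{n+2}-\beta^*_{n+1} & \text{if } \beta^*_{n+1}>0.\end{cases}$$ **Vertices.** Set $T_0 := 0$, $M_0 := 0$, $t_0 := 0$, $m_0 := 1$ and, for $n\ge 0$, $\Delta^*_n := (T_n+M_n)-(t_n+m_n)$. If $\Delta^*_n\le 0$, set $$T_{n+1} := T_n+M_n+\delta_n,\quad M_{n+1} := M_n+2\delta_n,\quad t_{n+1} := t_n+m_n,\quad m_{n+1} := m_n,$$ with $\delta_0 = 1$ and $\delta_n = 0$ for $n \ge 1$; if $\Delta^*_n>0$,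 set $$T_{n+1} := t_n+m_n,\quad M_{n+1} := M_n-\Delta^*_n\alpha_n,\quad t_{n+1} := T_n+M_n,\quad m_{n+1} := m_n+\Delta^*_n\alpha_{n+1}.$$ Let $G_n := (T_n,M_n)$, $g_n := (t_n,m_n)$, let $\mathcal P$ be the polygonal with consecutive vertices $G_0,g_0,G_1,g_1,G_2,g_2,\dots$, and let $\mathcal R(t,s) := (t+s,s)$. The *generalized graph* of a right-continuous function $v:[0,+\infty)\to[0,+\infty)$ of locally bounded variation is its graph, together with the vertical segments joining its left and right limits at each $t>0$ and the initial segment $\{0\}\times[0,v(0)]$. For $F\subset[0,+\infty)^2$ and $t\ge 0$ let $F_t := \{s : (t,s)\in F\}$; the *vertical rearrangement* of $F$ replaces each $F_t$ by $[0,|F_t|]$, where $|\cdot|$ is Lebesgue measure. **Theorem.** 1. For every $n\ge 0$: $t_n<T_{n+1}\le t_{n+1}$; the segment from $g_n$ to $G_{n+1}$ has slope $\alpha_n$; the segment from $G_{n+1}$ to $g_{n+1}$ has slope $\beta_n$, and $\beta_n\in[-\infty,0)$; the segment from $\mathcal R(G_{n+1})$ to $\mathcal R(g_{n+1})$ has slope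 $\beta^*_{n+1}$; and $\Delta^*_{n+1}>0$ if and only if $\beta^*_{n+1}>0$. (Slope $-\infty$ means a vertical segment traversed downwards.) 2. $\mathcal P$ is the generalized graph of one and only one right-continuous function $\ell:[0,+\infty)\to[0,+\infty)$ of locally bounded variation, and $\ell$ solves the free-boundary equation $$\ell(t) = u_0(t)+\bigl|\{s\in[0,t] : \ell(t-s)>s\}\bigr| \qquad \text{for all } t\in[0,+\infty).$$ 3. Vertical rearrangement is performed exactly when $\Delta^*_n>0$: let $F := \mathcal R(\{(t,s) : t\ge 0,\ 0\le s<\ell(t)\})$. For $t\ge 0$, the section $F_t$ differs from $[0,|F_t|]$ by more than a null set if and only if there is an $n\ge 0$ with $\Delta^*_n>0$ and $T_{n+1}<t<t_{n+1}$. -/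

import Mathlib

open Set Filter Topology MeasureTheory

noncomputable section

namespace RiemannFB

/-! ### The slope sequences -/

/-- `α n = 1 / (n + 1)`, defined by `α 0 = 1` and `1 / α (n + 1) = 1 / α n + 1`. -/
def alpha : ℕ → ℝ
  | 0 => 1
  | n + 1 => ((alpha n)⁻¹ + 1)⁻¹

open Classical in
/-- The value of `β* (n + 1)` obtained from `b = β n`: the reciprocal of `1 / b + 1`, where
`1 / (-∞) = 0`, and where `b = -1` gives `-∞`. -/
def betaStarOf (b : EReal) : EReal :=
  if b = ⊥ then 1 else if b = -1 then ⊥ else (b⁻¹ + 1)⁻¹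

open Classical in
/-- The slopes `β n`, with `β 0 = -∞`. -/
def beta : ℕ → EReal
  | 0 => ⊥
  | n + 1 =>
      if betaStarOf (beta n) ≤ 0 then betaStarOf (beta n)
      else ((alpha (n + 1) + alpha (n + 2) : ℝ) : EReal) - betaStarOf (beta n)

/-- `betaStarSucc n` is `β* (n + 1)`. -/
def betaStarSucc (n : ℕ) : EReal := betaStarOf (beta n)

/-! ### The vertices of the polygonal -/

/-- The quadruple `(T, M, t, m)`. -/
structure Vertices where
  T : ℝ
  M : ℝ
  t : ℝ
  m : ℝ

/-- `Δ* = (T + M) - (t + m)`. -/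
def Vertices.delta (p : Vertices) : ℝ := (p.T + p.M) - (p.t + p.m)

open Classical in
/-- The passage from `(T_n, M_n, t_n, m_n)` to `(T_{n+1}, M_{n+1}, t_{n+1}, m_{n+1})`.
The numbers `T + M`, `M`, `t + m`, `m` are the coordinates of the starred vertices. -/
def Vertices.next (n : ℕ) (p : Vertices) : Vertices :=
  if p.delta ≤ 0 then
    { T := p.T + p.M + (if n = 0 then 1 else 0)
      M := p.M + 2 * (if n = 0 then 1 else 0)
      t := p.t + p.m
      m := p.m }
  else
    { T := p.t + p.m
      M := p.M - p.delta * alpha n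
      t := p.T + p.M
      m := p.m + p.delta * alpha (n + 1) }

/-- The quadruple `(T_n, M_n, t_n, m_n)`. -/
def vertices : ℕ → Vertices
  | 0 => { T := 0, M := 0, t := 0, m := 1 }
  | n + 1 => (vertices n).next n

/-- `T_n`. -/
def topTime (n : ℕ) : ℝ := (vertices n).T

/-- `M_n`. -/
def topValue (n : ℕ) : ℝ := (vertices n).M

/-- `t_n`. -/
def lowTime (n : ℕ) : ℝ := (vertices n).t

/-- `m_n`. -/
def lowValue (n : ℕ) : ℝ := (vertices n).m

/-- `Δ*_n`. -/
def deltaStar (n : ℕ) : ℝ := (vertices n).delta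

/-- `G_n = (T_n, M_n)`. -/
def topPoint (n : ℕ) : ℝ × ℝ := (topTime n, topValue n)

/-- `g_n = (t_n, m_n)`. -/
def lowPoint (n : ℕ) : ℝ × ℝ := (lowTime n, lowValue n)

/-- The polygonal through `G_0, g_0, G_1, g_1, G_2, g_2, …`. -/
def polygonal : Set (ℝ × ℝ) :=
  ⋃ n : ℕ, segment ℝ (topPoint n) (lowPoint n) ∪ segment ℝ (lowPoint n) (topPoint (n + 1))

open Classical in
/-- The slope of the segment from `P` to `Q`; a vertical one that goes down has slope `-∞`. -/
def slopeOf (P Q : ℝ × ℝ) : EReal :=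
  if P.1 = Q.1 then (if Q.2 < P.2 then ⊥ else ⊤)
  else (((Q.2 - P.2) / (Q.1 - P.1) : ℝ) : EReal)

/-! ### Functions on `[0, ∞)` and their generalized graphs

A function on `[0, ∞)` is a function `ℝ → ℝ` of which only the values on `[0, ∞)` matter. -/

/-- The graph over `[0, ∞)`, with the vertical segments that join the left and the right limit
at the points `t > 0`, and with the initial vertical segment `{0} × [0, v 0]`. -/
def generalizedGraph (v : ℝ → ℝ) : Set (ℝ × ℝ) :=
  {p | 0 ≤ p.1 ∧ p.2 = v p.1} ∪
  {p | 0 < p.1 ∧ ∃ a b : ℝ, Tendsto v (𝓝[<] p.1) (𝓝 a) ∧ Tendsto v (𝓝[>] p.1) (𝓝 b) ∧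
    p.2 ∈ uIcc a b} ∪
  {p | p.1 = 0 ∧ p.2 ∈ Icc 0 (v 0)}

/-- `v : [0, ∞) → [0, ∞)` is right-continuous, of locally bounded variation, and its generalized
graph is the set `P`. -/
structure HasGeneralizedGraph (v : ℝ → ℝ) (P : Set (ℝ × ℝ)) : Prop where
  nonneg : ∀ t, 0 ≤ t → 0 ≤ v t
  locallyBoundedVariation : LocallyBoundedVariationOn v (Ici 0)
  right_continuous : ∀ t, 0 ≤ t → ContinuousWithinAt v (Ici t) t
  graph_eq : generalizedGraph v = P

/-! ### The free-boundary equation and the vertical rearrangement -/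

/-- The datum `1_{[0,1)}`. -/
def riemannDatum : ℝ → ℝ := indicator (Ico 0 1) (fun _ => 1)

/-- `ℓ t = u₀ t + |{s ∈ [0, t] : ℓ (t - s) > s}|` for all `t ≥ 0`. -/
def SolvesFreeBoundary (u₀ l : ℝ → ℝ) : Prop :=
  ∀ t, 0 ≤ t → l t = u₀ t + (volume {s : ℝ | s ∈ Icc 0 t ∧ l (t - s) > s}).toReal

/-- The affine transformation `(t, s) ↦ (t + s, s)`. -/
def shear (p : ℝ × ℝ) : ℝ × ℝ := (p.1 + p.2, p.2)

/-- The subgraph of `v` in `[0, ∞) × [0, ∞)`. -/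
def subgraphPos (v : ℝ → ℝ) : Set (ℝ × ℝ) := {p | 0 ≤ p.1 ∧ 0 ≤ p.2 ∧ v p.1 > p.2}

/-- The section of `F` over the abscissa `t`. -/
def fiber (F : Set (ℝ × ℝ)) (t : ℝ) : Set ℝ := {s | (t, s) ∈ F}

/-- The vertical rearrangement: every section `F_t`, `t ≥ 0`, is replaced by `[0, |F_t|]`. -/
def verticalRearrangement (F : Set (ℝ × ℝ)) : Set (ℝ × ℝ) :=
  {p | 0 ≤ p.1 ∧ 0 ≤ p.2 ∧ ENNReal.ofReal p.2 ≤ volume (fiber F p.1)}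

/-- The vertical rearrangement of `F` really changes (by more than a null set) the section of `F`
over `t`. -/
def RearrangedAt (F : Set (ℝ × ℝ)) (t : ℝ) : Prop :=
  ¬ (fiber (verticalRearrangement F) t =ᵐ[volume] fiber F t)

end RiemannFB

end

namespace RiemannFB

/-! Put `E_t = {r ≥ 0 : r + ℓ(r) ≤ t}` (`earlySet`). The substitution `r = t - s` turns the
free-boundary equation into `ℓ(t) = u₀(t) + t - |E_t|`, so everything reduces to computing `E_t` for
the piecewise affine function `profile` read off the polygonal.

The shear adds 1 to reciprocal slopes: the rise from `g_n` to `G_{n+1}`, of slope `α_n`, goes to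
slope `α_{n+1}`, and the fall from `G_{n+1}` to `g_{n+1}` goes from `β_n` to `β*_{n+1}`. If
`Δ*_{n+1} ≤ 0`, the sheared fall does not turn back and is itself the next fall; there `E_t = [0, t
- ℓ(t)]` (`earlySet_of_fall`), as on the rises beyond `t = 1` (`earlySet_of_rise`). If `Δ*_{n+1} >
0`, the sheared fall runs backwards over an interval of width `Δ*_{n+1}`, where it lies between the
sheared rises `n` and `n + 1`. The three sheets give `E_t = [0, x₁] ∪ [x₂, x₃]`
(`earlySet_of_fall_of_pos`), and `t - |E_t|` is affine of slope `α_{n+1} + α_{n+2} - β*_{n+1}`: this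
is the next fall. The hole that `[x₂, x₃]` leaves in the section over `t` is what the rearrangement
closes.

All of this needs the order of the vertices, an induction on several inequalities at once
(`vertex_bounds`). The signs of `β_n` and `β*_{n+1}` then follow from the geometry, not from their
recursion. Bounded variation follows from the equation, since `|E_t|` is monotone in `t`; uniqueness
holds because the jumps are isolated. -/

lemma alpha_eq (n : ℕ) : alpha n = 1 / ((n : ℝ) + 1) := by
  induction n with
  | zero => simp [alpha]
  | succ n ih => rw [alpha, ih]; push_cast; simp

lemma alpha_pos (n : ℕ) : 0 < alpha n := by rw [alpha_eq]; positivity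

lemma alpha_succ_mul (n : ℕ) : alpha (n + 1) * (1 + alpha n) = alpha n := by
  rw [alpha_eq, alpha_eq]; push_cast; field_simp

lemma alpha_succ_le (n : ℕ) : alpha (n + 1) ≤ 1 / 2 := by
  rw [alpha_eq]
  have : (0 : ℝ) ≤ n := n.cast_nonneg
  push_cast
  gcongr
  linarith

lemma alpha_add_two_le (n : ℕ) : alpha (n + 2) ≤ 1 / 3 := by
  rw [alpha_eq]
  have : (0 : ℝ) ≤ n := n.cast_nonneg
  push_cast
  gcongr
  linarith

/-! ### Vertices: recursions without case distinction, and bounds -/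

/-- The width of the interval on which the `n`-th rearrangement takes place. -/
noncomputable def excess (n : ℕ) : ℝ := max (deltaStar n) 0

lemma excess_nonneg (n : ℕ) : 0 ≤ excess n := le_max_right _ _

lemma excess_of_nonpos {n : ℕ} (h : deltaStar n ≤ 0) : excess n = 0 := max_eq_right h

lemma excess_of_pos {n : ℕ} (h : 0 < deltaStar n) : excess n = deltaStar n := max_eq_left h.le

lemma deltaStar_eq (n : ℕ) :
    deltaStar n = (topTime n + topValue n) - (lowTime n + lowValue n) := rfl

@[simp] lemma lowTime_zero : lowTime 0 = 0 := rfl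
@[simp] lemma lowValue_zero : lowValue 0 = 1 := rfl
@[simp] lemma topTime_zero : topTime 0 = 0 := rfl
@[simp] lemma topValue_zero : topValue 0 = 0 := rfl

lemma deltaStar_zero : deltaStar 0 = -1 := by simp [deltaStar_eq]

@[simp] lemma excess_zero : excess 0 = 0 :=
  excess_of_nonpos (by rw [deltaStar_zero]; norm_num)

lemma vertices_succ_of_nonpos {n : ℕ} (h : deltaStar n ≤ 0) :
    vertices (n + 1) = ⟨topTime n + topValue n + (if n = 0 then 1 else 0),
      topValue n + 2 * (if n = 0 then 1 else 0), lowTime n + lowValue n, lowValue n⟩ := by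
  have h' : (vertices n).delta ≤ 0 := h
  simp only [vertices, Vertices.next, if_pos h']
  rfl

lemma vertices_succ_of_pos {n : ℕ} (h : 0 < deltaStar n) :
    vertices (n + 1) = ⟨lowTime n + lowValue n, topValue n - deltaStar n * alpha n,
      topTime n + topValue n, lowValue n + deltaStar n * alpha (n + 1)⟩ := by
  have h' : ¬ (vertices n).delta ≤ 0 := not_le.2 h
  simp only [vertices, Vertices.next, if_neg h']
  rfl

lemma lowTime_succ (n : ℕ) : lowTime (n + 1) = lowTime n + lowValue n + excess n := by
  rcases le_or_gt (deltaStar n) 0 with h | h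
  · rw [excess_of_nonpos h, lowTime, vertices_succ_of_nonpos h, add_zero]
  · rw [excess_of_pos h, lowTime, vertices_succ_of_pos h, deltaStar_eq]; ring

lemma lowValue_succ (n : ℕ) : lowValue (n + 1) = lowValue n + excess n * alpha (n + 1) := by
  rcases le_or_gt (deltaStar n) 0 with h | h
  · rw [excess_of_nonpos h, lowValue, vertices_succ_of_nonpos h]; simp
  · rw [excess_of_pos h, lowValue, vertices_succ_of_pos h]

@[simp] lemma topTime_one : topTime 1 = 1 := by
  rw [topTime, vertices_succ_of_nonpos (by rw [deltaStar_zero]; norm_num)]; simp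

@[simp] lemma topValue_one : topValue 1 = 2 := by
  rw [topValue, vertices_succ_of_nonpos (by rw [deltaStar_zero]; norm_num)]; simp

@[simp] lemma lowTime_one : lowTime 1 = 1 := by rw [lowTime_succ]; simp

@[simp] lemma lowValue_one : lowValue 1 = 1 := by rw [lowValue_succ]; simp

/-- From index one on `δ` vanishes and `excess` merges both branches: the new `T` is the minimum of
`T + M` and `t + m`, and the new `t` is their maximum. -/
lemma topTime_add_two (n : ℕ) :
    topTime (n + 2) = topTime (n + 1) + topValue (n + 1) - excess (n + 1) := by
  rcases le_or_gt (deltaStar (n + 1)) 0 with h | h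
  · rw [excess_of_nonpos h, topTime, vertices_succ_of_nonpos h]; simp
  · rw [excess_of_pos h, topTime, vertices_succ_of_pos h, deltaStar_eq]; ring

lemma topValue_add_two (n : ℕ) :
    topValue (n + 2) = topValue (n + 1) - excess (n + 1) * alpha (n + 1) := by
  rcases le_or_gt (deltaStar (n + 1)) 0 with h | h
  · rw [excess_of_nonpos h, topValue, vertices_succ_of_nonpos h]; simp
  · rw [excess_of_pos h, topValue, vertices_succ_of_pos h]

/-- The bounds satisfied by the vertices of index at least one. -/
lemma vertex_bounds (n : ℕ) :
    1 ≤ lowValue (n + 1) ∧ lowValue (n + 1) < topValue (n + 1) ∧ topValue (n + 1) ≤ 2 ∧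
      topTime (n + 1) ≤ lowTime (n + 1) ∧ lowTime n < topTime (n + 1) ∧
      lowTime (n + 1) < topTime (n + 1) + topValue (n + 1) - excess (n + 1) := by
  induction n with
  | zero =>
    have h : deltaStar 1 = 1 := by simp [deltaStar_eq]; norm_num
    norm_num [excess, h]
  | succ n ih =>
    obtain ⟨h1, h2, h3, h4, -, h6⟩ := ih
    have ha := alpha_succ_le n
    have hb := alpha_add_two_le n
    have ha0 := alpha_pos (n + 1)
    have hb0 := alpha_pos (n + 2)
    have he := excess_nonneg (n + 1)
    -- Since `T ≤ t`, the excess is at most `M - m`. One step lowers `M - m` by the excess times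
    -- `α_{n+1} + α_{n+2} ≤ 1/2 + 1/3 < 1`, so the gap stays positive.
    have hd : excess (n + 1) ≤ topValue (n + 1) - lowValue (n + 1) := by
      apply max_le _ (by linarith)
      rw [deltaStar_eq]; linarith
    have hd' : topTime (n + 1) + topValue (n + 1) - (lowTime (n + 1) + lowValue (n + 1))
        ≤ excess (n + 1) := le_max_left _ _
    have p1 := mul_le_mul_of_nonneg_left ha he
    have p2 := mul_le_mul_of_nonneg_left hb he
    have p3 := mul_nonneg he ha0.le
    have p4 := mul_nonneg he hb0.le
    have hle : topTime (n + 2) ≤ lowTime (n + 2) := by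
      rw [topTime_add_two, lowTime_succ (n + 1)]
      rcases le_total (deltaStar (n + 1)) 0 with h | h
      · rw [excess, max_eq_right h]; rw [deltaStar_eq] at h; linarith
      · rw [excess, max_eq_left h]; rw [deltaStar_eq] at h ⊢; linarith
    have hlow : lowValue (n + 2) < topValue (n + 2) := by
      rw [lowValue_succ (n + 1), topValue_add_two]; linarith
    refine ⟨?_, hlow, ?_, hle, ?_, ?_⟩
    · rw [lowValue_succ (n + 1)]; linarith
    · rw [topValue_add_two]; linarith
    · rw [topTime_add_two]; exact h6
    -- In the folding case this amounts to `(1 + α_{n+1}) Δ* < M`, which follows from `α_{n+1} ≤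
    -- 1/2`, `Δ* ≤ M - m`, `1 ≤ m` and `M ≤ 2`.
    · have key : lowTime (n + 2) < topTime (n + 2) + topValue (n + 2) := by
        rw [topTime_add_two, lowTime_succ (n + 1), topValue_add_two]
        rcases le_total (deltaStar (n + 1)) 0 with h | h
        · rw [excess, max_eq_right h] at *; linarith
        · have : excess (n + 1) = deltaStar (n + 1) := max_eq_left h
          rw [deltaStar_eq] at this
          linarith
      have hm : 1 ≤ lowValue (n + 2) := by rw [lowValue_succ (n + 1)]; linarith
      rcases le_total (deltaStar (n + 2)) 0 with h | h
      · have : excess (n + 1 + 1) = 0 := max_eq_right h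
        rw [this]; linarith
      · have : excess (n + 1 + 1) = deltaStar (n + 2) := max_eq_left h
        rw [this, deltaStar_eq]
        linarith

lemma one_le_lowValue : ∀ n, 1 ≤ lowValue n
  | 0 => le_rfl
  | n + 1 => (vertex_bounds n).1

lemma lowValue_lt_topValue (n : ℕ) : lowValue (n + 1) < topValue (n + 1) := (vertex_bounds n).2.1

lemma topTime_le_lowTime (n : ℕ) : topTime (n + 1) ≤ lowTime (n + 1) := (vertex_bounds n).2.2.2.1

lemma lowTime_lt_topTime (n : ℕ) : lowTime n < topTime (n + 1) := (vertex_bounds n).2.2.2.2.1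

lemma add_one_le_lowTime_succ (n : ℕ) : lowTime n + 1 ≤ lowTime (n + 1) := by
  rw [lowTime_succ]; linarith [one_le_lowValue n, excess_nonneg n]

lemma lowTime_strictMono : StrictMono lowTime :=
  strictMono_nat_of_lt_succ fun n => by linarith [add_one_le_lowTime_succ n]

lemma natCast_le_lowTime (n : ℕ) : (n : ℝ) ≤ lowTime n := by
  induction n with
  | zero => simp
  | succ n ih => push_cast; linarith [add_one_le_lowTime_succ n]

lemma lowTime_nonneg (n : ℕ) : 0 ≤ lowTime n := n.cast_nonneg.trans (natCast_le_lowTime n)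

lemma topTime_succ_mono : Monotone fun n => topTime (n + 1) :=
  monotone_nat_of_le_succ fun n =>
    (topTime_le_lowTime n).trans (lowTime_lt_topTime (n + 1)).le

/-- `G (n + 1)` lies on the line of slope `α n` through `g n`. -/
lemma topValue_succ_eq (n : ℕ) :
    topValue (n + 1) = lowValue n + alpha n * (topTime (n + 1) - lowTime n) := by
  induction n with
  | zero => norm_num [alpha]
  | succ n ih =>
    have h := alpha_succ_mul n
    rw [topValue_add_two, topTime_add_two, lowTime_succ, lowValue_succ]
    -- The sheared rise has slope `α_{n+1}`; the next vertices are obtained by sliding its ends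
    -- along this same line by the respective excesses.
    have e : alpha (n + 1) * (topTime (n + 1) + topValue (n + 1) - lowTime n - lowValue n)
        = topValue (n + 1) - lowValue n := by
      rw [ih]
      linear_combination (topTime (n + 1) - lowTime n) * h
    linear_combination -e

/-! ### The slopes -/

lemma slopeOf_vertical {a b b' : ℝ} (h : b' < b) : slopeOf (a, b) (a, b') = ⊥ := by
  simp [slopeOf, h]

lemma slopeOf_of_ne {a a' b b' : ℝ} (h : a ≠ a') :
    slopeOf (a, b) (a', b') = (((b' - b) / (a' - a) : ℝ) : EReal) := by
  simp [slopeOf, h]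

/-- The increment `(Δt, Δs)` becomes `(Δt + Δs, Δs)`, so 1 is added to the reciprocal slope. A
vertical segment (`⊥`) gets slope 1, and slope -1 becomes vertical. -/
lemma slopeOf_shear {P Q : ℝ × ℝ} (h1 : P.1 ≤ Q.1) (h2 : Q.2 < P.2) :
    slopeOf (shear P) (shear Q) = betaStarOf (slopeOf P Q) := by
  obtain ⟨p, q⟩ := P
  obtain ⟨p', q'⟩ := Q
  change p ≤ p' at h1
  change q' < q at h2
  change slopeOf (p + q, q) (p' + q', q') = _
  rw [betaStarOf]
  rcases h1.eq_or_lt with rfl | h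
  · have : (q' - q) / (p + q' - (p + q)) = 1 := by
      rw [div_eq_one_iff_eq (by linarith)]; ring
    rw [slopeOf_vertical h2, if_pos rfl, slopeOf_of_ne (by linarith), this]; rfl
  · rw [slopeOf_of_ne h.ne, if_neg (EReal.coe_ne_bot _)]
    have hp : 0 < p' - p := by linarith
    have hq : q' - q ≠ 0 := by linarith
    have hiff : (((q' - q) / (p' - p) : ℝ) : EReal) = -1 ↔ p + q = p' + q' := by
      rw [show (-1 : EReal) = ((-1 : ℝ) : EReal) from rfl, EReal.coe_eq_coe_iff,
        div_eq_iff hp.ne']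
      constructor <;> intro h <;> linarith
    by_cases hc : p + q = p' + q'
    · rw [if_pos (hiff.2 hc), hc, slopeOf_vertical h2]
    · rw [slopeOf_of_ne hc, if_neg (fun h => hc (hiff.1 h))]
      rw [show (1 : EReal) = ((1 : ℝ) : EReal) from rfl, ← EReal.coe_inv, ← EReal.coe_add,
        ← EReal.coe_inv, EReal.coe_eq_coe_iff, inv_div, div_add_one hq, inv_div]
      congr 1
      ring

lemma slopeOf_neg {P Q : ℝ × ℝ} (h1 : P.1 ≤ Q.1) (h2 : Q.2 < P.2) : slopeOf P Q < 0 := by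
  rw [slopeOf]
  split_ifs with h
  · exact EReal.bot_lt_zero
  · rw [← EReal.coe_zero, EReal.coe_lt_coe_iff]
    exact div_neg_of_neg_of_pos (by linarith) (by linarith [lt_of_le_of_ne h1 h])

lemma slopeOf_pos_of_lt {P Q : ℝ × ℝ} (h1 : Q.1 < P.1) (h2 : Q.2 < P.2) : 0 < slopeOf P Q := by
  rw [slopeOf, if_neg h1.ne', ← EReal.coe_zero, EReal.coe_lt_coe_iff]
  exact div_pos_of_neg_of_neg (by linarith) (by linarith)

lemma slopeOf_low_top (n : ℕ) : slopeOf (lowPoint n) (topPoint (n + 1)) = (alpha n : EReal) := by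
  have h := lowTime_lt_topTime n
  rw [slopeOf, lowPoint, topPoint, if_neg h.ne, EReal.coe_eq_coe_iff,
    div_eq_iff (by simp only; linarith)]
  simp only
  rw [topValue_succ_eq n]; ring

lemma slopeOf_shear_top_low (n : ℕ) :
    slopeOf (shear (topPoint (n + 1))) (shear (lowPoint (n + 1))) =
      betaStarOf (slopeOf (topPoint (n + 1)) (lowPoint (n + 1))) :=
  slopeOf_shear (topTime_le_lowTime n) (lowValue_lt_topValue n)

/-- The ordinate decreases along the sheared fall, so its slope is positive exactly when the segment
runs to the left, and `Δ*` is the length of that run. -/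
lemma slopeOf_shear_pos_iff (n : ℕ) :
    0 < deltaStar (n + 1) ↔
      0 < slopeOf (shear (topPoint (n + 1))) (shear (lowPoint (n + 1))) := by
  have h2 : (shear (lowPoint (n + 1))).2 < (shear (topPoint (n + 1))).2 := lowValue_lt_topValue n
  constructor
  · intro h
    refine slopeOf_pos_of_lt ?_ h2
    rw [deltaStar_eq] at h
    simp only [shear, topPoint, lowPoint]; linarith
  · intro h
    by_contra hd
    refine absurd h (slopeOf_neg ?_ h2).not_gt
    rw [deltaStar_eq] at hd
    simp only [shear, topPoint, lowPoint]; linarith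

/-- Without folding, the next fall is the sheared one. With folding it has width `Δ*` and drop `(M -
m) - Δ* (α_{n+1} + α_{n+2})`, while `β* = (M - m) / Δ*`. -/
lemma slopeOf_top_low (n : ℕ) : slopeOf (topPoint (n + 1)) (lowPoint (n + 1)) = beta n := by
  induction n with
  | zero => norm_num [slopeOf, topPoint, lowPoint, beta]
  | succ n ih =>
    have hs := slopeOf_shear_top_low n
    have hiff := slopeOf_shear_pos_iff n
    rw [ih] at hs
    rw [beta, ← hs]
    rcases le_or_gt (deltaStar (n + 1)) 0 with h | h
    · rw [if_pos (not_lt.1 fun h' => h.not_gt (hiff.2 h'))]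
      simp only [topPoint, lowPoint, shear, topTime_add_two, topValue_add_two,
        lowTime_succ (n + 1), lowValue_succ (n + 1), excess_of_nonpos h]
      simp
    · rw [if_neg (not_le.2 (hiff.1 h))]
      have hd := deltaStar_eq (n + 1)
      simp only [topPoint, lowPoint, shear]
      rw [slopeOf_of_ne, slopeOf_of_ne (by linarith), ← EReal.coe_sub, EReal.coe_eq_coe_iff]
      · have e1 : lowTime (n + 1 + 1) - topTime (n + 1 + 1) = deltaStar (n + 1) := by
          rw [topTime_add_two, lowTime_succ (n + 1), excess_of_pos h]; linarith
        have e2 : lowTime (n + 1) + lowValue (n + 1) - (topTime (n + 1) + topValue (n + 1))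
            = - deltaStar (n + 1) := by linarith
        rw [e1, e2, topValue_add_two, lowValue_succ (n + 1), excess_of_pos h]
        field_simp
        ring
      · rw [topTime_add_two, lowTime_succ (n + 1), excess_of_pos h]
        intro h'; linarith

/-! ### The function whose generalized graph is the polygonal -/

lemma exists_lt_lowTime_succ (t : ℝ) : ∃ n, t < lowTime (n + 1) := by
  obtain ⟨n, hn⟩ := exists_nat_gt t
  exact ⟨n, hn.trans_le ((natCast_le_lowTime n).trans (lowTime_strictMono n.lt_succ_self).le)⟩

open Classical in
/-- The index `n` such that `t_n ≤ t < t_{n+1}`. -/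
noncomputable def timeIndex (t : ℝ) : ℕ := Nat.find (exists_lt_lowTime_succ t)

/-- The slope of the segment from `G_{n+1}` to `g_{n+1}`, when it is not vertical. -/
noncomputable def fallSlope (n : ℕ) : ℝ :=
  (lowValue (n + 1) - topValue (n + 1)) / (lowTime (n + 1) - topTime (n + 1))

open Classical in
/-- The right-continuous function with generalized graph `polygonal`. -/
noncomputable def profile (t : ℝ) : ℝ :=
  if t < topTime (timeIndex t + 1) then
    lowValue (timeIndex t) + alpha (timeIndex t) * (t - lowTime (timeIndex t))
  else topValue (timeIndex t + 1) + fallSlope (timeIndex t) * (t - topTime (timeIndex t + 1))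

lemma timeIndex_spec {t : ℝ} (ht : 0 ≤ t) :
    t ∈ Ico (lowTime (timeIndex t)) (lowTime (timeIndex t + 1)) := by
  classical
  refine ⟨?_, Nat.find_spec (exists_lt_lowTime_succ t)⟩
  rcases h : timeIndex t with _ | k
  · simpa using ht
  · exact not_lt.1 (Nat.find_min (exists_lt_lowTime_succ t) (m := k)
      (by rw [timeIndex] at h; omega))

lemma index_unique {t : ℝ} {n k : ℕ} (hn : t ∈ Ico (lowTime n) (lowTime (n + 1)))
    (hk : t ∈ Ico (lowTime k) (lowTime (k + 1))) : n = k := by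
  have h1 := lowTime_strictMono.lt_iff_lt.1 (hn.1.trans_lt hk.2)
  have h2 := lowTime_strictMono.lt_iff_lt.1 (hk.1.trans_lt hn.2)
  omega

lemma timeIndex_eq {t : ℝ} {n : ℕ} (hn : t ∈ Ico (lowTime n) (lowTime (n + 1))) :
    timeIndex t = n :=
  index_unique (timeIndex_spec ((lowTime_nonneg n).trans hn.1)) hn

lemma exists_mem_rise_or_fall {t : ℝ} (ht : 0 ≤ t) :
    ∃ n, t ∈ Ico (lowTime n) (topTime (n + 1)) ∨ t ∈ Ico (topTime (n + 1)) (lowTime (n + 1)) := by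
  obtain ⟨h1, h2⟩ := timeIndex_spec ht
  refine ⟨timeIndex t, ?_⟩
  rcases lt_or_ge t (topTime (timeIndex t + 1)) with h | h
  exacts [.inl ⟨h1, h⟩, .inr ⟨h, h2⟩]

lemma profile_of_rise {n : ℕ} {t : ℝ} (h : t ∈ Ico (lowTime n) (topTime (n + 1))) :
    profile t = lowValue n + alpha n * (t - lowTime n) := by
  have e : timeIndex t = n := timeIndex_eq ⟨h.1, h.2.trans_le (topTime_le_lowTime n)⟩
  rw [profile, e, if_pos h.2]

lemma profile_of_fall {n : ℕ} {t : ℝ} (h : t ∈ Ico (topTime (n + 1)) (lowTime (n + 1))) :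
    profile t = topValue (n + 1) + fallSlope n * (t - topTime (n + 1)) := by
  have e : timeIndex t = n := timeIndex_eq ⟨(lowTime_lt_topTime n).le.trans h.1, h.2⟩
  rw [profile, e, if_neg h.1.not_gt]

lemma fallSlope_mul {n : ℕ} (h : topTime (n + 1) < lowTime (n + 1)) :
    fallSlope n * (lowTime (n + 1) - topTime (n + 1)) = lowValue (n + 1) - topValue (n + 1) :=
  div_mul_cancel₀ _ (by linarith)

lemma fallSlope_neg {n : ℕ} (h : topTime (n + 1) < lowTime (n + 1)) : fallSlope n < 0 :=
  div_neg_of_neg_of_pos (by linarith [lowValue_lt_topValue n]) (by linarith)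

lemma profile_of_fall' {n : ℕ} {t : ℝ} (h : t ∈ Ico (topTime (n + 1)) (lowTime (n + 1))) :
    profile t = lowValue (n + 1) + fallSlope n * (t - lowTime (n + 1)) := by
  rw [profile_of_fall h]
  linear_combination fallSlope_mul (h.1.trans_lt h.2)

lemma one_le_profile {t : ℝ} (ht : 0 ≤ t) : 1 ≤ profile t := by
  obtain ⟨n, h | h⟩ := exists_mem_rise_or_fall ht
  · rw [profile_of_rise h]
    linarith [one_le_lowValue n, mul_nonneg (alpha_pos n).le (sub_nonneg.2 h.1)]
  · rw [profile_of_fall' h]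
    linarith [one_le_lowValue (n + 1),
      mul_nonneg_of_nonpos_of_nonpos (fallSlope_neg (h.1.trans_lt h.2)).le (sub_nonpos.2 h.2.le)]

lemma profile_zero_of_lt_one {t : ℝ} (h : t ∈ Ico (0 : ℝ) 1) : profile t = 1 + t := by
  rw [profile_of_rise (n := 0) (by simpa using h)]; simp [alpha]

/-! ### The image of the polygonal under the shear -/

lemma shear_rise_bounds {n : ℕ} {t : ℝ} (h : t ∈ Ico (lowTime n) (topTime (n + 1))) :
    lowTime n + lowValue n ≤ t + profile t ∧
      t + profile t < topTime (n + 1) + topValue (n + 1) := by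
  have ha := alpha_pos n
  rw [profile_of_rise h, topValue_succ_eq n]
  constructor
  · linarith [h.1, mul_nonneg ha.le (sub_nonneg.2 h.1)]
  · linarith [h.2, mul_lt_mul_of_pos_left h.2 ha]

lemma topTime_add_two_le (n : ℕ) :
    topTime (n + 2) ≤ topTime (n + 1) + topValue (n + 1) := by
  rw [topTime_add_two]; linarith [excess_nonneg (n + 1)]

lemma le_lowTime_succ (n : ℕ) : lowTime n + lowValue n ≤ lowTime (n + 1) := by
  rw [lowTime_succ]; linarith [excess_nonneg n]

lemma top_le_lowTime_add_two (n : ℕ) :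
    topTime (n + 1) + topValue (n + 1) ≤ lowTime (n + 2) := by
  have := le_max_left (deltaStar (n + 1)) 0
  rw [deltaStar_eq] at this
  rw [lowTime_succ, excess, deltaStar_eq]; linarith

lemma topTime_add_two_le' (n : ℕ) :
    topTime (n + 2) ≤ lowTime (n + 1) + lowValue (n + 1) := by
  have := le_max_left (deltaStar (n + 1)) 0
  rw [deltaStar_eq] at this
  rw [topTime_add_two, excess, deltaStar_eq]; linarith

/-- The map `r ↦ r + ℓ(r)` is affine on a fall, and its end values `T + M` and `t + m` lie in
`[T_{n+2}, t_{n+2}]`. The sign of `1 + fallSlope n` decides which end gives which bound. -/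
lemma shear_fall_bounds {n : ℕ} {t : ℝ} (h : t ∈ Ico (topTime (n + 1)) (lowTime (n + 1))) :
    topTime (n + 2) ≤ t + profile t ∧ t + profile t ≤ lowTime (n + 2) := by
  have h1 := profile_of_fall h
  have h2 := profile_of_fall' h
  have a1 := topTime_add_two_le n
  have a2 := topTime_add_two_le' n
  have b1 := le_lowTime_succ (n + 1)
  have b2 := top_le_lowTime_add_two n
  rcases le_total 0 (1 + fallSlope n) with hb | hb
  · have p1 := mul_nonneg hb (sub_nonneg.2 h.1)
    have p2 := mul_nonneg hb (sub_nonneg.2 h.2.le)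
    constructor
    · rw [h1]; linarith
    · rw [h2]; linarith
  · have p1 := mul_nonneg (neg_nonneg.2 hb) (sub_nonneg.2 h.1)
    have p2 := mul_nonneg (neg_nonneg.2 hb) (sub_nonneg.2 h.2.le)
    constructor
    · rw [h2]; linarith
    · rw [h1]; linarith

/-- Together with `le_shear_of_ge`, this confines the comparison of `r + ℓ(r)` with a given abscissa
to a few consecutive pieces. -/
lemma shear_le_of_lt {n : ℕ} {t : ℝ} (ht : 0 ≤ t) (h : t < lowTime n) :
    t + profile t ≤ lowTime (n + 1) := by
  obtain ⟨k, hk⟩ := exists_mem_rise_or_fall ht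
  have hkn : k < n := by
    apply lowTime_strictMono.lt_iff_lt.1
    rcases hk with hk | hk
    exacts [hk.1.trans_lt h, (lowTime_lt_topTime k).trans_le hk.1 |>.trans h]
  have hmono : lowTime (k + 2) ≤ lowTime (n + 1) := lowTime_strictMono.monotone (by omega)
  rcases hk with hk | hk
  · exact (shear_rise_bounds hk).2.le.trans ((top_le_lowTime_add_two k).trans hmono)
  · exact (shear_fall_bounds hk).2.trans hmono

lemma le_shear_of_ge {n : ℕ} {t : ℝ} (h : topTime (n + 1) ≤ t) :
    topTime (n + 2) ≤ t + profile t := by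
  have hT := lowTime_lt_topTime n
  obtain ⟨k, hk⟩ := exists_mem_rise_or_fall ((lowTime_nonneg n).trans (hT.le.trans h))
  rcases hk with hk | hk
  · have hkn : n < k := by
      by_contra hc
      exact absurd (h.trans_lt hk.2) (topTime_succ_mono (not_lt.1 hc)).not_gt
    obtain ⟨j, rfl⟩ : ∃ j, k = j + 1 := ⟨k - 1, by omega⟩
    exact (topTime_succ_mono (by omega : n + 1 ≤ j + 1)).trans
      ((topTime_add_two_le' j).trans (shear_rise_bounds hk).1)
  · have hkn : n ≤ k := by
      by_contra hc
      have : lowTime (k + 1) ≤ lowTime n := lowTime_strictMono.monotone (by omega)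
      linarith [hk.2]
    exact (topTime_succ_mono (by omega : n + 1 ≤ k + 1)).trans (shear_fall_bounds hk).1

/-! ### The sets of early abscissae, piece by piece -/

/-- The abscissae of the points of the graph of `profile` that the shear moves to an abscissa
at most `t`. -/
def earlySet (t : ℝ) : Set ℝ := {r | 0 ≤ r ∧ r + profile r ≤ t}

lemma earlySet_of_lt_one {t : ℝ} (h : t < 1) : earlySet t = ∅ := by
  ext r
  simp only [earlySet, mem_ofPred_eq, mem_empty_iff_false, iff_false, not_and, not_le]
  intro hr
  linarith [one_le_profile hr]

/-- On rise `n` the map `r ↦ r + ℓ(r)` has slope `1 + α_n`, so its inverse has slope `1 - α_{n+1}`.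
-/
lemma one_sub_alpha_mul (n : ℕ) : (1 - alpha (n + 1)) * (1 + alpha n) = 1 := by
  linear_combination -alpha_succ_mul n

lemma alpha_succ_lt_one (n : ℕ) : 0 < 1 - alpha (n + 1) := by linarith [alpha_succ_le n]

lemma le_iff_of_mul_eq {a c x y : ℝ} (ha : 0 < a) (h : a * x = c) : a * y ≤ c ↔ y ≤ x := by
  rw [← h, mul_le_mul_iff_right₀ ha]

lemma earlySet_of_rise {n : ℕ} {t : ℝ} (h : t ∈ Ico (lowTime (n + 1)) (topTime (n + 2))) :
    earlySet t = Icc 0 (t - profile t) ∧ profile t ≤ t := by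
  have ha := alpha_pos n
  have hp : profile t = lowValue n + alpha (n + 1) * (t - lowTime n - lowValue n) := by
    rw [profile_of_rise h, lowValue_succ, lowTime_succ]; ring
  -- This says that `x = t - ℓ(t)` solves `x + ℓ(x) = t` on the line of rise `n`.
  have key : (1 + alpha n) * (t - profile t - lowTime n) = t - lowTime n - lowValue n := by
    rw [hp]
    linear_combination (t - lowTime n - lowValue n) * one_sub_alpha_mul n
  have hlow := le_lowTime_succ n
  have hx1 : lowTime n ≤ t - profile t := by
    rw [hp]
    have := mul_nonneg (alpha_succ_lt_one n).le (by linarith [h.1] : 0 ≤ t - lowTime n - lowValue n)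
    linarith
  have hx2 : t - profile t < topTime (n + 1) := by
    have h1 := h.2.trans_le (topTime_add_two_le n)
    rw [topValue_succ_eq n] at h1
    have := lt_of_mul_lt_mul_left (a := 1 + alpha n) (b := t - profile t - lowTime n)
      (c := topTime (n + 1) - lowTime n) (by rw [key]; linarith) (by linarith)
    linarith
  refine ⟨?_, by linarith [lowTime_nonneg n]⟩
  ext r
  simp only [earlySet, mem_ofPred_eq, mem_Icc]
  refine and_congr_right fun hr => ?_
  rcases lt_or_ge r (lowTime n) with h1 | h1
  · exact iff_of_true ((shear_le_of_lt hr h1).trans h.1) (by linarith)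
  rcases lt_or_ge r (topTime (n + 1)) with h2 | h2
  · have := le_iff_of_mul_eq (y := r - lowTime n) (by linarith : 0 < 1 + alpha n) key
    rw [profile_of_rise ⟨h1, h2⟩]
    constructor
    · intro h3; linarith [this.1 (by linarith)]
    · intro h3; linarith [this.2 (by linarith)]
  · exact iff_of_false (by linarith [le_shear_of_ge h2, h.2]) (by linarith)

lemma earlySet_of_fall {n : ℕ} {t : ℝ} (h : t ∈ Ico (topTime (n + 2)) (lowTime (n + 2)))
    (hd : deltaStar (n + 1) ≤ 0) :
    earlySet t = Icc 0 (t - profile t) ∧ profile t ≤ t := by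
  have he := excess_of_nonpos hd
  have eT := topTime_add_two n
  have eM := topValue_add_two n
  have et := lowTime_succ (n + 1)
  have em := lowValue_succ (n + 1)
  simp only [he, sub_zero, zero_mul, add_zero] at eT eM et em
  have hlt : topTime (n + 2) < lowTime (n + 2) := h.1.trans_lt h.2
  have hMm := lowValue_lt_topValue n
  have hlt0 : topTime (n + 1) < lowTime (n + 1) := by rw [eT, et] at hlt; linarith
  have hb := fallSlope_mul hlt0
  have hb' := fallSlope_mul hlt
  have hneg' := fallSlope_neg hlt
  rw [et, em, eT, eM] at hb'
  -- The next fall is the shear of this one, hence the same inverse relation as for the rises.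
  have hmul : (1 - fallSlope (n + 1)) * (1 + fallSlope n) = 1 := by
    have hne : lowTime (n + 1) - topTime (n + 1) ≠ 0 := by linarith
    apply mul_right_cancel₀ hne
    linear_combination (1 - fallSlope (n + 1)) * hb - hb'
  have hpos : 0 < 1 + fallSlope n := by
    by_contra hc
    have := mul_nonneg (by linarith : 0 ≤ 1 - fallSlope (n + 1)) (by linarith : 0 ≤ -(1 + fallSlope n))
    linarith
  have hp := profile_of_fall h
  rw [eM] at hp
  have key : (1 + fallSlope n) * (t - profile t - topTime (n + 1)) = t - topTime (n + 2) := by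
    rw [hp, eT]
    linear_combination (t - topTime (n + 1) - topValue (n + 1)) * hmul
  have hx1 : topTime (n + 1) ≤ t - profile t := by
    have := (le_iff_of_mul_eq (y := 0) hpos key).1 (by linarith [h.1])
    linarith
  have hx2 : t - profile t < lowTime (n + 1) := by
    have := lt_of_mul_lt_mul_left (a := 1 + fallSlope n) (b := t - profile t - topTime (n + 1))
      (c := lowTime (n + 1) - topTime (n + 1)) (by rw [key]; linarith [h.2]) hpos.le
    linarith
  refine ⟨?_, by linarith [lowTime_nonneg n, lowTime_lt_topTime n]⟩
  ext r
  simp only [earlySet, mem_ofPred_eq, mem_Icc]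
  refine and_congr_right fun hr => ?_
  rcases lt_or_ge r (lowTime n) with h1 | h1
  · exact iff_of_true ((shear_le_of_lt hr h1).trans ((lowTime_lt_topTime (n + 1)).le.trans h.1))
      (by linarith [lowTime_lt_topTime n])
  rcases lt_or_ge r (topTime (n + 1)) with h2 | h2
  · exact iff_of_true (by linarith [(shear_rise_bounds ⟨h1, h2⟩).2, h.1]) (by linarith)
  rcases lt_or_ge r (lowTime (n + 1)) with h3 | h3
  · have := le_iff_of_mul_eq (y := r - topTime (n + 1)) hpos key
    rw [profile_of_fall ⟨h2, h3⟩]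
    constructor
    · intro h3; linarith [this.1 (by linarith)]
    · intro h3; linarith [this.2 (by linarith)]
  rcases lt_or_ge r (topTime (n + 2)) with h4 | h4
  · exact iff_of_false (by linarith [(shear_rise_bounds ⟨h3, h4⟩).1, h.2]) (by linarith)
  · exact iff_of_false (by linarith [le_shear_of_ge h4, h.2, lowTime_lt_topTime (n + 2)])
      (by linarith)

/-- The points `x₁`, `x₂`, `x₃` are the abscissae on rise `n`, fall `n` and rise `n + 1` that are
sheared to `t`, with `x₂` the base of the jump if fall `n` is vertical. At the left end `t =
T_{n+2}` the last two merge into `t_{n+1}`, which is why rearrangement starts only after it. -/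
lemma earlySet_of_fall_of_pos {n : ℕ} {t : ℝ} (h : t ∈ Ico (topTime (n + 2)) (lowTime (n + 2)))
    (hd : 0 < deltaStar (n + 1)) :
    ∃ x₁ x₂ x₃ : ℝ, 0 ≤ x₁ ∧ x₁ < x₂ ∧ x₂ ≤ x₃ ∧ x₃ ≤ t ∧ (x₂ < x₃ ↔ topTime (n + 2) < t) ∧
      profile t = t - x₁ - (x₃ - x₂) ∧ earlySet t = Icc 0 x₁ ∪ Icc x₂ x₃ := by
  have he := excess_of_pos hd
  have eT := topTime_add_two n
  have eM := topValue_add_two n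
  have et := lowTime_succ (n + 1)
  have em := lowValue_succ (n + 1)
  have eD := deltaStar_eq (n + 1)
  rw [he] at eT eM et em
  set D := deltaStar (n + 1) with hDdef
  have hlt : topTime (n + 2) < lowTime (n + 2) := h.1.trans_lt h.2
  have eD' : lowTime (n + 2) - topTime (n + 2) = D := by rw [et, eT]; linarith
  have hle := topTime_le_lowTime n
  have ha := alpha_pos n
  have ha' := alpha_pos (n + 1)
  have hMm := lowValue_lt_topValue n
  set d := lowTime (n + 1) - topTime (n + 1) with hddef
  have hd0 : 0 ≤ d := by linarith
  set u := t - topTime (n + 2) with hu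
  have hu0 : 0 ≤ u := by linarith [h.1]
  have huD : u < D := by linarith [h.2]
  have huD1 : u / D < 1 := (div_lt_one hd).2 huD
  have huD0 : 0 ≤ u / D := div_nonneg hu0 hd.le
  have huDm : u / D * D = u := div_mul_cancel₀ _ hd.ne'
  obtain ⟨x₁, hx₁⟩ : ∃ x, x = topTime (n + 1) - (1 - alpha (n + 1)) * (D - u) := ⟨_, rfl⟩
  -- Linear interpolation from `t_{n+1}` at `u = 0` back to `T_{n+1}` at `u = D`; unlike a formula
  -- with `fallSlope n`, it remains valid for a vertical fall, where `d = 0`.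
  obtain ⟨x₂, hx₂⟩ : ∃ x, x = lowTime (n + 1) - d * (u / D) := ⟨_, rfl⟩
  obtain ⟨x₃, hx₃⟩ : ∃ x, x = lowTime (n + 1) + (1 - alpha (n + 2)) * u := ⟨_, rfl⟩
  have k1 : (1 + alpha n) * (x₁ - lowTime n) = t - lowTime n - lowValue n := by
    have hline := topValue_succ_eq n
    rw [hx₁]
    linear_combination (u - D) * one_sub_alpha_mul n - hline + hu - eT
  have k3 : (1 + alpha (n + 1)) * (x₃ - lowTime (n + 1)) = u := by
    rw [hx₃]
    linear_combination u * one_sub_alpha_mul (n + 1)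
  have hlow := le_lowTime_succ n
  have hlT := lowTime_lt_topTime (n + 1)
  have b1 : lowTime n ≤ x₁ := by
    have := (le_iff_of_mul_eq (y := 0) (by linarith : 0 < 1 + alpha n) k1).1 (by linarith [h.1])
    linarith
  have b1' : x₁ < topTime (n + 1) := by
    rw [hx₁]; linarith [mul_pos (alpha_succ_lt_one n) (sub_pos.2 huD)]
  have b2 : topTime (n + 1) ≤ x₂ := by
    rw [hx₂]; linarith [mul_le_mul_of_nonneg_left huD1.le hd0]
  have b2' : x₂ ≤ lowTime (n + 1) := by
    rw [hx₂]; linarith [mul_nonneg hd0 huD0]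
  have b3 : lowTime (n + 1) ≤ x₃ := by
    rw [hx₃]; linarith [mul_nonneg (alpha_succ_lt_one (n + 1)).le hu0]
  have b3' : x₃ < topTime (n + 2) := by
    have q1 := topTime_add_two_le (n + 1)
    have q2 := lowTime_lt_topTime (n + 2)
    have q3 := topValue_succ_eq (n + 1)
    have := lt_of_mul_lt_mul_left (a := 1 + alpha (n + 1)) (b := x₃ - lowTime (n + 1))
      (c := topTime (n + 2) - lowTime (n + 1)) (by rw [k3]; linarith [h.2]) (by linarith)
    linarith
  refine ⟨x₁, x₂, x₃, (lowTime_nonneg n).trans b1, b1'.trans_le b2, b2'.trans b3,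
    b3'.le.trans h.1, ?_, ?_, ?_⟩
  · constructor
    · intro hx
      by_contra hc
      have : u = 0 := le_antisymm (by linarith) hu0
      rw [hx₂, hx₃, this] at hx
      simp at hx
    · intro ht
      have : 0 < u := by linarith
      have := mul_pos (alpha_succ_lt_one (n + 1)) this
      rw [hx₃]; linarith
  · have hb' := fallSlope_mul hlt
    have e1 : fallSlope (n + 1) = (lowValue (n + 1) - topValue (n + 1)) / D
        + alpha (n + 1) + alpha (n + 2) := by
      rw [eD', em, eM] at hb'
      field_simp
      linarith
    rw [profile_of_fall h, e1, eM, hx₁, hx₂, hx₃, ← hu]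
    have e2 : (lowValue (n + 1) - topValue (n + 1)) = -D - d := by linarith
    rw [e2]
    field_simp
    have e3 : t = u + topTime (n + 1) + topValue (n + 1) - D := by linarith
    rw [e3]; ring
  · ext r
    simp only [earlySet, mem_ofPred_eq, mem_Icc, mem_union]
    by_cases hr : 0 ≤ r
    swap
    · refine iff_of_false (fun h => hr h.1) ?_
      rintro (h | h)
      · exact hr h.1
      · linarith [lowTime_nonneg n]
    simp only [hr, true_and]
    rcases lt_or_ge r (lowTime n) with h1 | h1
    · exact iff_of_true ((shear_le_of_lt hr h1).trans (hlT.le.trans h.1)) (.inl (by linarith))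
    rcases lt_or_ge r (topTime (n + 1)) with h2 | h2
    · have := le_iff_of_mul_eq (y := r - lowTime n) (by linarith : 0 < 1 + alpha n) k1
      rw [profile_of_rise ⟨h1, h2⟩]
      constructor
      · intro h3; left; linarith [this.1 (by linarith)]
      · rintro (h3 | h3)
        · linarith [this.2 (by linarith)]
        · linarith
    rcases lt_or_ge r (lowTime (n + 1)) with h3 | h3
    · have hdp : 0 < d := by linarith
      have hb := fallSlope_mul (h2.trans_lt h3)
      have k2 : (D / d) * (lowTime (n + 1) - x₂) = u := by
        rw [hx₂]; field_simp; ring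
      have e4 : 1 + fallSlope n = - (D / d) := by
        rw [← hddef] at hb
        field_simp
        linarith
      have := mul_le_mul_iff_right₀ (b := lowTime (n + 1) - r) (c := lowTime (n + 1) - x₂)
        (div_pos hd hdp)
      rw [k2, show D / d = - (1 + fallSlope n) by linarith] at this
      rw [profile_of_fall' ⟨h2, h3⟩]
      constructor
      · intro h5
        exact .inr ⟨by linarith [this.1 (by linarith)], by linarith⟩
      · rintro (h5 | h5)
        · linarith
        · linarith [this.2 (by linarith [h5.1])]
    rcases lt_or_ge r (topTime (n + 2)) with h4 | h4
    · have := le_iff_of_mul_eq (y := r - lowTime (n + 1)) (by linarith : 0 < 1 + alpha (n + 1)) k3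
      rw [profile_of_rise ⟨h3, h4⟩]
      constructor
      · intro h5; exact .inr ⟨by linarith, by linarith [this.1 (by linarith)]⟩
      · rintro (h5 | h5)
        · linarith
        · linarith [this.2 (by linarith [h5.2])]
    · exact iff_of_false (by linarith [le_shear_of_ge h4, h.2, lowTime_lt_topTime (n + 2)])
        (by rintro (h5 | h5) <;> linarith)

/-! ### Generalized graphs -/

lemma mem_segment_vertical {a c d : ℝ} {p : ℝ × ℝ} :
    p ∈ segment ℝ (a, c) (a, d) ↔ p.1 = a ∧ p.2 ∈ uIcc c d := by
  rw [← Prod.image_mk_segment_right, segment_eq_uIcc]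
  obtain ⟨x, y⟩ := p
  simp only [mem_image, Prod.mk.injEq]
  constructor
  · rintro ⟨z, hz, rfl, rfl⟩; exact ⟨rfl, hz⟩
  · rintro ⟨rfl, hz⟩; exact ⟨y, hz, rfl, rfl⟩

lemma mem_segment_of_lt {a b c d s : ℝ} (h : a < b) (hs : s * (b - a) = d - c) {p : ℝ × ℝ} :
    p ∈ segment ℝ (a, c) (b, d) ↔ p.1 ∈ Icc a b ∧ p.2 = c + s * (p.1 - a) := by
  obtain ⟨x, y⟩ := p
  have hba : 0 < b - a := by linarith
  rw [segment_eq_image']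
  simp only [mem_image, Prod.mk_sub_mk, Prod.smul_mk, Prod.mk_add_mk, Prod.mk.injEq, smul_eq_mul]
  constructor
  · rintro ⟨θ, ⟨h0, h1⟩, rfl, rfl⟩
    refine ⟨⟨by linarith [mul_nonneg h0 hba.le], by linarith [mul_le_mul_of_nonneg_right h1 hba.le]⟩, ?_⟩
    linear_combination -θ * hs
  · rintro ⟨⟨h0, h1⟩, rfl⟩
    refine ⟨(x - a) / (b - a), ⟨div_nonneg (by linarith) hba.le, (div_le_one hba).2 (by linarith)⟩,
      ?_, ?_⟩
    · field_simp; ring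
    · rw [← hs]; field_simp

lemma mem_rise_segment {n : ℕ} {p : ℝ × ℝ} :
    p ∈ segment ℝ (lowPoint n) (topPoint (n + 1)) ↔
      p.1 ∈ Icc (lowTime n) (topTime (n + 1)) ∧
        p.2 = lowValue n + alpha n * (p.1 - lowTime n) :=
  mem_segment_of_lt (lowTime_lt_topTime n) (by rw [topValue_succ_eq n]; ring)

lemma mem_fall_segment {n : ℕ} (h : topTime (n + 1) < lowTime (n + 1)) {p : ℝ × ℝ} :
    p ∈ segment ℝ (topPoint (n + 1)) (lowPoint (n + 1)) ↔
      p.1 ∈ Icc (topTime (n + 1)) (lowTime (n + 1)) ∧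
        p.2 = topValue (n + 1) + fallSlope n * (p.1 - topTime (n + 1)) :=
  mem_segment_of_lt h (fallSlope_mul h)

lemma mem_jump_segment {n : ℕ} (h : topTime (n + 1) = lowTime (n + 1)) {p : ℝ × ℝ} :
    p ∈ segment ℝ (topPoint (n + 1)) (lowPoint (n + 1)) ↔
      p.1 = lowTime (n + 1) ∧ p.2 ∈ uIcc (topValue (n + 1)) (lowValue (n + 1)) := by
  rw [topPoint, lowPoint, h, mem_segment_vertical]

lemma mem_polygonal {p : ℝ × ℝ} :
    p ∈ polygonal ↔ (p.1 = 0 ∧ p.2 ∈ Icc (0 : ℝ) 1) ∨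
      ∃ n, p ∈ segment ℝ (lowPoint n) (topPoint (n + 1)) ∨
        p ∈ segment ℝ (topPoint (n + 1)) (lowPoint (n + 1)) := by
  have h0 : p ∈ segment ℝ (topPoint 0) (lowPoint 0) ↔ p.1 = 0 ∧ p.2 ∈ Icc (0 : ℝ) 1 := by
    rw [← uIcc_of_le zero_le_one]
    exact mem_segment_vertical
  simp only [polygonal, mem_iUnion, mem_union]
  constructor
  · rintro ⟨n, h | h⟩
    · rcases n with _ | n
      exacts [.inl (h0.1 h), .inr ⟨n, .inr h⟩]
    · exact .inr ⟨n, .inl h⟩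
  · rintro (h | ⟨n, h | h⟩)
    exacts [⟨0, .inl (h0.2 h)⟩, ⟨n, .inr h⟩, ⟨n + 1, .inl h⟩]

lemma tendsto_rise {n : ℕ} {t : ℝ} {l : Filter ℝ} (hl : l ≤ 𝓝 t)
    (h : Ico (lowTime n) (topTime (n + 1)) ∈ l) :
    Tendsto profile l (𝓝 (lowValue n + alpha n * (t - lowTime n))) := by
  have hc : Continuous fun s => lowValue n + alpha n * (s - lowTime n) := by fun_prop
  refine ((hc.tendsto t).mono_left hl).congr' ?_
  filter_upwards [h] with s hs using (profile_of_rise hs).symm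

lemma tendsto_fall {n : ℕ} {t : ℝ} {l : Filter ℝ} (hl : l ≤ 𝓝 t)
    (h : Ico (topTime (n + 1)) (lowTime (n + 1)) ∈ l) :
    Tendsto profile l (𝓝 (topValue (n + 1) + fallSlope n * (t - topTime (n + 1)))) := by
  have hc : Continuous fun s => topValue (n + 1) + fallSlope n * (s - topTime (n + 1)) := by
    fun_prop
  refine ((hc.tendsto t).mono_left hl).congr' ?_
  filter_upwards [h] with s hs using (profile_of_fall hs).symm

lemma profile_right_continuous {t : ℝ} (ht : 0 ≤ t) : ContinuousWithinAt profile (Ici t) t := by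
  obtain ⟨n, h | h⟩ := exists_mem_rise_or_fall ht
  · rw [ContinuousWithinAt, profile_of_rise h]
    exact tendsto_rise nhdsWithin_le_nhds
      (mem_of_superset (Ico_mem_nhdsGE h.2) (Ico_subset_Ico_left h.1))
  · rw [ContinuousWithinAt, profile_of_fall h]
    exact tendsto_fall nhdsWithin_le_nhds
      (mem_of_superset (Ico_mem_nhdsGE h.2) (Ico_subset_Ico_left h.1))

lemma profile_tendsto_right {t : ℝ} (ht : 0 ≤ t) : Tendsto profile (𝓝[>] t) (𝓝 (profile t)) :=
  (profile_right_continuous ht).mono Ioi_subset_Ici_self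

lemma profile_tendsto_left_rise {n : ℕ} {t : ℝ} (h : t ∈ Ioc (lowTime n) (topTime (n + 1))) :
    Tendsto profile (𝓝[<] t) (𝓝 (lowValue n + alpha n * (t - lowTime n))) :=
  tendsto_rise nhdsWithin_le_nhds
    (mem_of_superset (Ico_mem_nhdsLT h.1) (Ico_subset_Ico_right h.2))

lemma profile_tendsto_left_fall {n : ℕ} {t : ℝ}
    (h : t ∈ Ioc (topTime (n + 1)) (lowTime (n + 1))) :
    Tendsto profile (𝓝[<] t) (𝓝 (topValue (n + 1) + fallSlope n * (t - topTime (n + 1)))) :=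
  tendsto_fall nhdsWithin_le_nhds
    (mem_of_superset (Ico_mem_nhdsLT h.1) (Ico_subset_Ico_right h.2))

lemma profile_continuousAt_rise {n : ℕ} {t : ℝ} (h : t ∈ Ioo (lowTime n) (topTime (n + 1))) :
    ContinuousAt profile t := by
  rw [ContinuousAt, profile_of_rise ⟨h.1.le, h.2⟩]
  exact tendsto_rise le_rfl (Ico_mem_nhds h.1 h.2)

lemma profile_continuousAt_fall {n : ℕ} {t : ℝ}
    (h : t ∈ Ioo (topTime (n + 1)) (lowTime (n + 1))) : ContinuousAt profile t := by
  rw [ContinuousAt, profile_of_fall ⟨h.1.le, h.2⟩]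
  exact tendsto_fall le_rfl (Ico_mem_nhds h.1 h.2)

lemma profile_lowTime (n : ℕ) : profile (lowTime n) = lowValue n := by
  rw [profile_of_rise ⟨le_rfl, lowTime_lt_topTime n⟩]; simp

lemma mem_polygonal_profile {t : ℝ} (ht : 0 ≤ t) : (t, profile t) ∈ polygonal := by
  obtain ⟨n, h | h⟩ := exists_mem_rise_or_fall ht
  · exact mem_polygonal.2 (.inr ⟨n, .inl (mem_rise_segment.2 ⟨⟨h.1, h.2.le⟩, profile_of_rise h⟩)⟩)
  · exact mem_polygonal.2 (.inr ⟨n, .inr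
      ((mem_fall_segment (h.1.trans_lt h.2)).2 ⟨⟨h.1, h.2.le⟩, profile_of_fall h⟩)⟩)

lemma exists_mem_Ioc_rise_or_fall {t : ℝ} (ht : 0 < t) :
    ∃ n, t ∈ Ioc (lowTime n) (topTime (n + 1)) ∨ t ∈ Ioc (topTime (n + 1)) (lowTime (n + 1)) := by
  obtain ⟨n, h⟩ := exists_mem_rise_or_fall ht.le
  have hT := lowTime_lt_topTime n
  have hle := topTime_le_lowTime n
  rcases h with h | h
  · rcases h.1.eq_or_lt with rfl | h1
    · obtain ⟨k, rfl⟩ : ∃ k, n = k + 1 :=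
        ⟨n - 1, by rcases n with _ | n <;> [simp at ht; rfl]⟩
      rcases (topTime_le_lowTime k).eq_or_lt with h2 | h2
      · exact ⟨k, .inl ⟨h2 ▸ lowTime_lt_topTime k, h2.ge⟩⟩
      · exact ⟨k, .inr ⟨h2, le_rfl⟩⟩
    · exact ⟨n, .inl ⟨h1, h.2.le⟩⟩
  · rcases h.1.eq_or_lt with rfl | h1
    · exact ⟨n, .inl ⟨hT, le_rfl⟩⟩
    · exact ⟨n, .inr ⟨h1, h.2.le⟩⟩

/-- Adjacent pieces agree at their common end, except where a fall degenerates to a vertical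
segment. -/
lemma profile_mem_jump_or_tendsto_left {t : ℝ} (ht : 0 < t) :
    Tendsto profile (𝓝[<] t) (𝓝 (profile t)) ∨
      ∃ n, topTime (n + 1) = lowTime (n + 1) ∧ t = lowTime (n + 1) ∧
        Tendsto profile (𝓝[<] t) (𝓝 (topValue (n + 1))) := by
  obtain ⟨n, h | h⟩ := exists_mem_Ioc_rise_or_fall ht
  · have hl := profile_tendsto_left_rise h
    rcases h.2.eq_or_lt with rfl | h2
    · rw [← topValue_succ_eq n] at hl
      rcases (topTime_le_lowTime n).eq_or_lt with h3 | h3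
      · exact .inr ⟨n, h3, h3, hl⟩
      · left
        rw [profile_of_fall ⟨le_rfl, h3⟩]
        simpa using hl
    · left
      rwa [profile_of_rise ⟨h.1.le, h2⟩]
  · have hl := profile_tendsto_left_fall h
    left
    rcases h.2.eq_or_lt with rfl | h2
    · rw [profile_lowTime]
      rwa [fallSlope_mul h.1, add_sub_cancel] at hl
    · rwa [profile_of_fall ⟨h.1.le, h2⟩]

lemma generalizedGraph_profile : generalizedGraph profile = polygonal := by
  have h01 : profile 0 = 1 := by simpa using profile_lowTime 0
  ext p
  constructor
  · rintro ((⟨h, e⟩ | ⟨h, a, b, ha, hb, hp⟩) | ⟨h, hp⟩)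
    · have := mem_polygonal_profile h
      rwa [← e] at this
    · obtain rfl := tendsto_nhds_unique hb (profile_tendsto_right h.le)
      rcases profile_mem_jump_or_tendsto_left h with hl | ⟨n, h1, h2, hl⟩
      · obtain rfl := tendsto_nhds_unique ha hl
        rw [uIcc_self, mem_singleton_iff] at hp
        have := mem_polygonal_profile h.le
        rwa [← hp] at this
      · obtain rfl := tendsto_nhds_unique ha hl
        rw [h2, profile_lowTime] at hp
        exact mem_polygonal.2 (.inr ⟨n, .inr ((mem_jump_segment h1).2 ⟨h2, hp⟩)⟩)
    · exact mem_polygonal.2 (.inl ⟨h, by rwa [h01] at hp⟩)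
  · have jump : ∀ n, topTime (n + 1) = lowTime (n + 1) → p.1 = lowTime (n + 1) →
        p.2 ∈ uIcc (topValue (n + 1)) (lowValue (n + 1)) → p ∈ generalizedGraph profile := by
      intro n hn h1 h2
      have hT := lowTime_lt_topTime n
      have hpos : 0 < p.1 := by rw [h1, ← hn]; exact (lowTime_nonneg n).trans_lt hT
      refine .inl (.inr ⟨hpos, _, _, ?_, profile_tendsto_right hpos.le,
        by rwa [h1, profile_lowTime]⟩)
      rw [topValue_succ_eq n, hn, ← h1]
      exact profile_tendsto_left_rise ⟨by rwa [h1, ← hn], by rw [h1, hn]⟩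
    intro hp
    rcases mem_polygonal.1 hp with ⟨h1, h2⟩ | ⟨n, h | h⟩
    · exact .inr ⟨h1, by rwa [h01]⟩
    · obtain ⟨⟨h1, h2⟩, h3⟩ := mem_rise_segment.1 h
      have hpos : 0 ≤ p.1 := (lowTime_nonneg n).trans h1
      rcases h2.eq_or_lt with h2 | h2
      · rw [h2, ← topValue_succ_eq n] at h3
        rcases (topTime_le_lowTime n).eq_or_lt with h4 | h4
        · exact jump n h4 (h2.trans h4) (by rw [h3]; exact left_mem_uIcc)
        · refine .inl (.inl ⟨hpos, ?_⟩)
          rw [h2, h3, profile_of_fall ⟨le_rfl, h4⟩]; simp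
      · exact .inl (.inl ⟨hpos, by rw [h3, profile_of_rise ⟨h1, h2⟩]⟩)
    · rcases (topTime_le_lowTime n).eq_or_lt with h4 | h4
      · obtain ⟨h1, h2⟩ := (mem_jump_segment h4).1 h
        exact jump n h4 h1 h2
      · obtain ⟨⟨h1, h2⟩, h3⟩ := (mem_fall_segment h4).1 h
        have hpos : 0 ≤ p.1 := (lowTime_nonneg n).trans ((lowTime_lt_topTime n).le.trans h1)
        refine .inl (.inl ⟨hpos, ?_⟩)
        rcases h2.eq_or_lt with h2 | h2
        · rw [h3, h2, profile_lowTime, fallSlope_mul h4]; ring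
        · rw [h3, profile_of_fall ⟨h1, h2⟩]

/-- A right-continuous function whose discontinuities do not accumulate from the right is
determined by its generalized graph. -/
lemma eqOn_of_generalizedGraph_eq {v w : ℝ → ℝ} (h : generalizedGraph w = generalizedGraph v)
    (hv : ∀ t, 0 ≤ t → ContinuousWithinAt v (Ici t) t)
    (hw : ∀ t, 0 ≤ t → ContinuousWithinAt w (Ici t) t)
    (hc : ∀ t, 0 ≤ t → ∀ᶠ s in 𝓝[>] t, ContinuousAt v s) : EqOn w v (Ici 0) := by
  intro t ht
  -- Where `v` is continuous its vertical segment is a single point, so the graph forces `w s = v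
  -- s`; right-continuity then carries the equality to `t`.
  have hev : v =ᶠ[𝓝[>] t] w := by
    filter_upwards [hc t ht, self_mem_nhdsWithin] with s hs hts
    have hs0 : 0 < s := lt_of_le_of_lt ht hts
    have hmem : (s, w s) ∈ generalizedGraph v := h ▸ .inl (.inl ⟨hs0.le, rfl⟩)
    rcases hmem with (⟨-, e⟩ | ⟨-, a, b, ha, hb, hp⟩) | ⟨h1, -⟩
    · exact e.symm
    · obtain rfl := tendsto_nhds_unique ha (hs.tendsto.mono_left nhdsWithin_le_nhds)
      obtain rfl := tendsto_nhds_unique hb (hs.tendsto.mono_left nhdsWithin_le_nhds)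
      rw [uIcc_self, mem_singleton_iff] at hp
      exact hp.symm
    · exact absurd h1 hs0.ne'
  exact tendsto_nhds_unique ((hw t ht).mono Ioi_subset_Ici_self)
    (((hv t ht).mono Ioi_subset_Ici_self).congr' hev)

lemma eventually_continuousAt_profile {t : ℝ} (ht : 0 ≤ t) :
    ∀ᶠ s in 𝓝[>] t, ContinuousAt profile s := by
  obtain ⟨n, h | h⟩ := exists_mem_rise_or_fall ht
  · filter_upwards [Ioo_mem_nhdsGT h.2] with s hs
    exact profile_continuousAt_rise ⟨h.1.trans_lt hs.1, hs.2⟩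
  · filter_upwards [Ioo_mem_nhdsGT h.2] with s hs
    exact profile_continuousAt_fall ⟨h.1.trans_lt hs.1, hs.2⟩

/-! ### The set of arrivals and the free-boundary equation -/

/-- The ordinates `s` for which `(t, s)` is in the sheared subgraph of `profile`. -/
def arrivalSet (t : ℝ) : Set ℝ := {s | s ∈ Icc 0 t ∧ profile (t - s) > s}

lemma mem_arrivalSet {t s : ℝ} : s ∈ arrivalSet t ↔ 0 ≤ s ∧ s ≤ t ∧ t - s ∉ earlySet t := by
  simp only [arrivalSet, earlySet, mem_ofPred_eq, mem_Icc, and_assoc]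
  refine and_congr_right fun _ => and_congr_right fun h => ?_
  rw [not_and, imp_iff_right (sub_nonneg.2 h), not_le]
  constructor <;> intro h' <;> linarith

/-- The three possible shapes of `earlySet t`. -/
lemma earlySet_cases {t : ℝ} (ht : 0 ≤ t) :
    (t < 1 ∧ profile t = 1 + t ∧ earlySet t = ∅) ∨
    (1 ≤ t ∧ profile t ≤ t ∧ earlySet t = Icc 0 (t - profile t)) ∨
    (1 ≤ t ∧ ∃ n, 0 < deltaStar n ∧ t ∈ Ico (topTime (n + 1)) (lowTime (n + 1)) ∧
      ∃ x₁ x₂ x₃ : ℝ, 0 ≤ x₁ ∧ x₁ < x₂ ∧ x₂ ≤ x₃ ∧ x₃ ≤ t ∧ (x₂ < x₃ ↔ topTime (n + 1) < t) ∧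
        profile t = t - x₁ - (x₃ - x₂) ∧ earlySet t = Icc 0 x₁ ∪ Icc x₂ x₃) := by
  rcases lt_or_ge t 1 with h1 | h1
  · exact .inl ⟨h1, profile_zero_of_lt_one ⟨ht, h1⟩, earlySet_of_lt_one h1⟩
  right
  obtain ⟨n, h⟩ := exists_mem_rise_or_fall ht
  -- The pieces of index 0 lie in `[0, 1)`, because `T_1 = t_1 = 1`.
  obtain ⟨k, rfl⟩ : ∃ k, n = k + 1 := by
    refine ⟨n - 1, ?_⟩
    rcases n with _ | n
    · norm_num at h; linarith [h.2]
    · rfl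
  rcases h with h | h
  · exact .inl ⟨h1, (earlySet_of_rise h).2, (earlySet_of_rise h).1⟩
  · rcases le_or_gt (deltaStar (k + 1)) 0 with hd | hd
    · exact .inl ⟨h1, (earlySet_of_fall h hd).2, (earlySet_of_fall h hd).1⟩
    · exact .inr ⟨h1, k + 1, hd, h, earlySet_of_fall_of_pos h hd⟩

lemma not_rearranging_of_earlySet_eq {t : ℝ}
    (he : earlySet t = Icc 0 (t - profile t)) :
    ¬ ∃ n, 0 < deltaStar n ∧ t ∈ Ioo (topTime (n + 1)) (lowTime (n + 1)) := by
  rintro ⟨n, hd, ht⟩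
  obtain ⟨k, rfl⟩ : ∃ k, n = k + 1 := by
    refine ⟨n - 1, ?_⟩
    rcases n with _ | n
    · norm_num [deltaStar_zero] at hd
    · rfl
  obtain ⟨x₁, x₂, x₃, h0, h12, h23, h3, hiff, hp, he'⟩ :=
    earlySet_of_fall_of_pos ⟨ht.1.le, ht.2⟩ hd
  have h23' := hiff.2 ht.1
  have m1 : x₃ ∈ earlySet t := he' ▸ .inr ⟨h23, le_rfl⟩
  rw [he] at m1
  linarith [m1.2]

lemma measureReal_two_intervals {a b c d : ℝ} (hab : a ≤ b) (hbc : b < c) (hcd : c ≤ d) :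
    (volume (Icc a b ∪ Icc c d)).toReal = (b - a) + (d - c) := by
  rw [measure_union _ measurableSet_Icc, Real.volume_Icc, Real.volume_Icc,
    ← ENNReal.ofReal_add (by linarith) (by linarith), ENNReal.toReal_ofReal (by linarith)]
  · rw [Set.disjoint_left]
    intro x hx hx'
    linarith [hx.2, hx'.1]

lemma riemannDatum_of_lt {t : ℝ} (h0 : 0 ≤ t) (h : t < 1) : riemannDatum t = 1 :=
  indicator_of_mem (show t ∈ Ico (0 : ℝ) 1 from ⟨h0, h⟩) _

lemma riemannDatum_of_ge {t : ℝ} (h : 1 ≤ t) : riemannDatum t = 0 :=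
  indicator_of_notMem (fun h' => h.not_gt h'.2) _

lemma profile_eq_sub_volume {t : ℝ} (ht : 0 ≤ t) :
    profile t = riemannDatum t + t - (volume (earlySet t)).toReal := by
  rcases earlySet_cases ht with ⟨h1, hp, he⟩ | ⟨h1, hp, he⟩ |
    ⟨h1, n, -, -, x₁, x₂, x₃, h0, h12, h23, h3, -, hp, he⟩
  · rw [he, hp, riemannDatum_of_lt ht h1]; simp
  · rw [he, riemannDatum_of_ge h1, Real.volume_Icc, ENNReal.toReal_ofReal (by linarith)]; ring
  · rw [he, hp, riemannDatum_of_ge h1, measureReal_two_intervals h0 h12 h23]; ring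

lemma earlySet_subset (t : ℝ) : earlySet t ⊆ Icc 0 t := fun r hr =>
  ⟨hr.1, by linarith [hr.2, one_le_profile hr.1]⟩

lemma measurableSet_earlySet {t : ℝ} (ht : 0 ≤ t) : MeasurableSet (earlySet t) := by
  rcases earlySet_cases ht with ⟨_, _, he⟩ | ⟨_, _, he⟩ |
    ⟨_, _, _, _, _, _, _, _, _, _, _, _, _, he⟩ <;>
    rw [he]
  exacts [MeasurableSet.empty, measurableSet_Icc, measurableSet_Icc.union measurableSet_Icc]

lemma volume_earlySet_ne_top (t : ℝ) : volume (earlySet t) ≠ ⊤ :=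
  measure_ne_top_of_subset (earlySet_subset t) (by simp)

lemma volume_earlySet_mono {t t' : ℝ} (h : t ≤ t') :
    (volume (earlySet t)).toReal ≤ (volume (earlySet t')).toReal :=
  ENNReal.toReal_mono (volume_earlySet_ne_top t')
    (measure_mono fun _ hr => ⟨hr.1, hr.2.trans h⟩)

lemma arrivalSet_eq_preimage (t : ℝ) :
    arrivalSet t = (fun s => t - s) ⁻¹' (Icc 0 t \ earlySet t) := by
  ext s
  rw [mem_arrivalSet]
  simp only [mem_preimage, Set.mem_sdiff, mem_Icc]
  constructor
  · rintro ⟨h1, h2, h3⟩; exact ⟨⟨by linarith, by linarith⟩, h3⟩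
  · rintro ⟨⟨h1, h2⟩, h3⟩; exact ⟨by linarith, by linarith, h3⟩

lemma profile_solves : SolvesFreeBoundary riemannDatum profile := by
  intro t ht
  change _ = _ + (volume (arrivalSet t)).toReal
  have hm := measurableSet_earlySet ht
  rw [arrivalSet_eq_preimage, (Measure.measurePreserving_sub_left volume t).measure_preimage
      (measurableSet_Icc.diff hm).nullMeasurableSet,
    measure_sdiff (earlySet_subset t) hm.nullMeasurableSet (volume_earlySet_ne_top t),
    ENNReal.toReal_sub_of_le (measure_mono (earlySet_subset t)) (by simp), Real.volume_Icc,
    ENNReal.toReal_ofReal (by linarith), profile_eq_sub_volume ht]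
  ring

/-! ### Bounded variation -/

lemma eVariationOn_le_of_dist_le {f g : ℝ → ℝ} {s : Set ℝ}
    (h : ∀ x ∈ s, ∀ y ∈ s, x ≤ y → |f y - f x| ≤ |g y - g x|) :
    eVariationOn f s ≤ eVariationOn g s := by
  refine iSup_le ?_
  rintro ⟨n, ⟨u, hu, us⟩⟩
  refine (Finset.sum_le_sum fun i _ => ?_).trans (eVariationOn.sum_le hu us (n := n))
  rw [edist_dist, edist_dist]
  exact ENNReal.ofReal_le_ofReal (h _ (us _) _ (us _) (hu i.le_succ))

lemma profile_locallyBoundedVariationOn : LocallyBoundedVariationOn profile (Ici 0) := by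
  have hd : AntitoneOn riemannDatum (Ici 0) := by
    intro x hx y hy hxy
    rcases lt_or_ge y 1 with h | h
    · rw [riemannDatum_of_lt hx (hxy.trans_lt h), riemannDatum_of_lt hy h]
    · rw [riemannDatum_of_ge h]
      exact indicator_nonneg (fun _ _ => zero_le_one) _
  -- In `ℓ = u₀ + t - |E_t|` every term is monotone; `g` adds them with signs making each
  -- nondecreasing, so its increments dominate those of `ℓ`.
  let g : ℝ → ℝ := fun t => t + (volume (earlySet t)).toReal - riemannDatum t
  have hg : MonotoneOn g (Ici 0) := by
    intro x hx y hy hxy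
    have h1 := volume_earlySet_mono hxy
    have h2 := hd hx hy hxy
    simp only [g]; linarith
  intro a b ha hb
  refine ne_top_of_le_ne_top (hg.locallyBoundedVariationOn a b ha hb)
    (eVariationOn_le_of_dist_le ?_)
  rintro x ⟨hx, -⟩ y ⟨hy, -⟩ hxy
  refine le_trans ?_ (le_abs_self _)
  have h1 := volume_earlySet_mono hxy
  have h2 := hd hx hy hxy
  rw [profile_eq_sub_volume hx, profile_eq_sub_volume hy]
  simp only [g]
  exact abs_le.2 ⟨by linarith, by linarith⟩

lemma profile_hasGeneralizedGraph : HasGeneralizedGraph profile polygonal where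
  nonneg _ ht := zero_le_one.trans (one_le_profile ht)
  locallyBoundedVariation := profile_locallyBoundedVariationOn
  right_continuous _ ht := profile_right_continuous ht
  graph_eq := generalizedGraph_profile

/-! ### The vertical rearrangement -/

lemma fiber_shear_subgraph (t : ℝ) : fiber (shear '' subgraphPos profile) t = arrivalSet t := by
  ext s
  simp only [fiber, subgraphPos, shear, arrivalSet, mem_ofPred_eq, mem_image, Prod.mk.injEq,
    mem_Icc]
  constructor
  · rintro ⟨p, ⟨h1, h2, h3⟩, h4, rfl⟩
    have : t - p.2 = p.1 := by linarith
    rw [this]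
    exact ⟨⟨h2, by linarith⟩, h3⟩
  · rintro ⟨⟨h1, h2⟩, h3⟩
    exact ⟨(t - s, s), ⟨sub_nonneg.2 h2, h1, h3⟩, by simp, rfl⟩

lemma arrivalSet_subset (t : ℝ) : arrivalSet t ⊆ Icc 0 t := fun _ hs => hs.1

lemma fiber_verticalRearrangement {F : Set (ℝ × ℝ)} {t : ℝ} (ht : 0 ≤ t)
    (hF : volume (fiber F t) ≠ ⊤) :
    fiber (verticalRearrangement F) t = Icc 0 (volume (fiber F t)).toReal := by
  ext s
  simp only [fiber, verticalRearrangement, mem_ofPred_eq, mem_Icc, ht, true_and]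
  exact and_congr_right fun hs => ENNReal.ofReal_le_iff_le_toReal hF

lemma rearrangedAt_iff {t : ℝ} (ht : 0 ≤ t) :
    RearrangedAt (shear '' subgraphPos profile) t ↔
      ¬ (Icc 0 (profile t - riemannDatum t) =ᵐ[volume] arrivalSet t) := by
  have hne : volume (arrivalSet t) ≠ ⊤ :=
    measure_ne_top_of_subset (arrivalSet_subset t) (by simp)
  have hv : (volume (arrivalSet t)).toReal = profile t - riemannDatum t :=
    eq_sub_of_add_eq' (profile_solves t ht).symm
  rw [RearrangedAt, fiber_verticalRearrangement ht (by rwa [fiber_shear_subgraph]),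
    fiber_shear_subgraph, hv]

lemma rearrangedAt_profile_iff {t : ℝ} (ht : 0 ≤ t) :
    RearrangedAt (shear '' subgraphPos profile) t ↔
      ∃ n : ℕ, 0 < deltaStar n ∧ t ∈ Ioo (topTime (n + 1)) (lowTime (n + 1)) := by
  rw [rearrangedAt_iff ht]
  rcases earlySet_cases ht with ⟨h1, hp, he⟩ | ⟨h1, hp, he⟩ |
    ⟨h1, n, hd, htn, x₁, x₂, x₃, h0, h12, h23, h3, hiff, hp, he⟩
  · refine iff_of_false (not_not.2 ?_) ?_
    · rw [riemannDatum_of_lt ht h1, hp]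
      have e : Icc 0 (1 + t - 1) = arrivalSet t := by
        ext s
        rw [mem_arrivalSet, he]
        simp
      rw [e]
      exact EventuallyEq.rfl
    · rintro ⟨n, -, hn⟩
      have := topTime_succ_mono n.zero_le
      simp only [zero_add, topTime_one] at this
      linarith [hn.1]
  · refine iff_of_false (not_not.2 ?_) (not_rearranging_of_earlySet_eq he)
    rw [riemannDatum_of_ge h1, sub_zero]
    have e : Ico 0 (profile t) = arrivalSet t := by
      ext s
      rw [mem_arrivalSet, he, mem_Icc, mem_Ico]
      constructor
      · rintro ⟨h2, h3⟩
        exact ⟨h2, by linarith, fun h4 => by linarith [h4.2]⟩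
      · rintro ⟨h2, h3, h4⟩
        refine ⟨h2, ?_⟩
        by_contra hc
        exact h4 ⟨by linarith, by linarith⟩
    rw [← e]
    exact Ico_ae_eq_Icc.symm
  · have hex : (∃ k : ℕ, 0 < deltaStar k ∧ t ∈ Ioo (topTime (k + 1)) (lowTime (k + 1))) ↔
        topTime (n + 1) < t := by
      constructor
      · rintro ⟨k, -, hk⟩
        have : k = n := index_unique
          ⟨(lowTime_lt_topTime k).le.trans hk.1.le, hk.2⟩
          ⟨(lowTime_lt_topTime n).le.trans htn.1, htn.2⟩
        exact this ▸ hk.1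
      · exact fun h => ⟨n, hd, h, htn.2⟩
    rw [hex, ← hiff, riemannDatum_of_ge h1, sub_zero, hp]
    have hnot : ∀ s, t - s ∉ Icc 0 x₁ ∪ Icc x₂ x₃ ↔
        (t - s < 0 ∨ x₁ < t - s) ∧ (t - s < x₂ ∨ x₃ < t - s) := by
      intro s
      simp only [mem_union, mem_Icc, not_or, not_and_or, not_le]
    constructor
    · intro h
      by_contra hc
      have h23' : x₂ = x₃ := le_antisymm h23 (not_lt.1 hc)
      apply h
      -- When `x₂ = x₃`, the section differs from the interval only at these two points.
      have hfin : ({t - x₃, t - x₁} : Set ℝ)ᶜ ∈ ae volume :=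
        compl_mem_ae_iff.2 ((Set.toFinite _).measure_zero volume)
      refine eventuallyEq_set.2 ?_
      filter_upwards [hfin] with s hs
      simp only [mem_compl_iff, mem_insert_iff, mem_singleton_iff, not_or] at hs
      rw [mem_arrivalSet, he, hnot, mem_Icc, h23', sub_self, sub_zero]
      constructor
      · rintro ⟨h5, h6⟩
        have h7 := lt_of_le_of_ne h6 hs.2
        refine ⟨h5, by linarith, .inr (by linarith), ?_⟩
        rcases lt_or_gt_of_ne hs.1 with h8 | h8
        exacts [.inr (by linarith), .inl (by linarith)]
      · rintro ⟨h5, h6, h7 | h7, -⟩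
        · linarith
        · exact ⟨h5, by linarith⟩
    · intro h hae
      -- The hole of the section is `[t - x₃, t - x₂]`; its part below the rearranged height has
      -- positive length because `x₂ < x₃` and `x₁ < x₂`.
      have hpos : t - x₃ < min (t - x₂) (t - x₁ - (x₃ - x₂)) :=
        lt_min (by linarith) (by linarith)
      have hsub : Ioo (t - x₃) (min (t - x₂) (t - x₁ - (x₃ - x₂))) ⊆
          Icc 0 (t - x₁ - (x₃ - x₂)) \ arrivalSet t := by
        rintro s ⟨h4, h5⟩
        rw [lt_min_iff] at h5
        refine ⟨⟨by linarith, h5.2.le⟩, fun h6 => ?_⟩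
        rw [mem_arrivalSet, he, hnot] at h6
        rcases h6.2.2.2 with h7 | h7 <;> linarith
      have hz := measure_mono_null hsub (ae_le_set.1 hae.le)
      rw [Real.volume_Ioo, ENNReal.ofReal_eq_zero] at hz
      linarith

end RiemannFB

theorem mainTheorem4 :
    -- order of the vertices, and slopes of the segments of the polygonal and of its image
    (∀ n : ℕ,
      RiemannFB.lowTime n < RiemannFB.topTime (n + 1) ∧
      RiemannFB.topTime (n + 1) ≤ RiemannFB.lowTime (n + 1) ∧
      RiemannFB.slopeOf (RiemannFB.lowPoint n) (RiemannFB.topPoint (n + 1)) =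
        (RiemannFB.alpha n : EReal) ∧
      RiemannFB.slopeOf (RiemannFB.topPoint (n + 1)) (RiemannFB.lowPoint (n + 1)) =
        RiemannFB.beta n ∧
      RiemannFB.beta n < 0 ∧
      RiemannFB.slopeOf (RiemannFB.shear (RiemannFB.topPoint (n + 1)))
        (RiemannFB.shear (RiemannFB.lowPoint (n + 1))) = RiemannFB.betaStarSucc n ∧
      (0 < RiemannFB.deltaStar (n + 1) ↔ 0 < RiemannFB.betaStarSucc n)) ∧
    -- the polygonal is the generalized graph of exactly one function `l` on `[0, ∞)`
    ∃ l : ℝ → ℝ,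
      RiemannFB.HasGeneralizedGraph l RiemannFB.polygonal ∧
      (∀ l' : ℝ → ℝ, RiemannFB.HasGeneralizedGraph l' RiemannFB.polygonal →
        EqOn l' l (Ici 0)) ∧
      -- this function solves the free-boundary equation
      RiemannFB.SolvesFreeBoundary RiemannFB.riemannDatum l ∧
      -- rearrangement takes place exactly over the intervals `(T_{n+1}, t_{n+1})`, `Δ*_n > 0`
      (∀ t : ℝ, 0 ≤ t →
        (RiemannFB.RearrangedAt (RiemannFB.shear '' RiemannFB.subgraphPos l) t ↔
          ∃ n : ℕ, 0 < RiemannFB.deltaStar n ∧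
            t ∈ Ioo (RiemannFB.topTime (n + 1)) (RiemannFB.lowTime (n + 1)))) := by
  refine ⟨fun n => ⟨RiemannFB.lowTime_lt_topTime n, RiemannFB.topTime_le_lowTime n,
    RiemannFB.slopeOf_low_top n, RiemannFB.slopeOf_top_low n, ?_, ?_, ?_⟩,
    RiemannFB.profile, RiemannFB.profile_hasGeneralizedGraph, fun l' hl' => ?_,
    RiemannFB.profile_solves, fun t ht => RiemannFB.rearrangedAt_profile_iff ht⟩
  · rw [← RiemannFB.slopeOf_top_low n]
    exact RiemannFB.slopeOf_neg (RiemannFB.topTime_le_lowTime n) (RiemannFB.lowValue_lt_topValue n)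
  · rw [RiemannFB.slopeOf_shear_top_low, RiemannFB.slopeOf_top_low, RiemannFB.betaStarSucc]
  · rw [RiemannFB.slopeOf_shear_pos_iff, RiemannFB.slopeOf_shear_top_low,
      RiemannFB.slopeOf_top_low, RiemannFB.betaStarSucc]
  · exact RiemannFB.eqOn_of_generalizedGraph_eq
      (hl'.graph_eq.trans RiemannFB.generalizedGraph_profile.symm)
      (fun _ => RiemannFB.profile_right_continuous) hl'.right_continuous
      (fun _ => RiemannFB.eventually_continuousAt_profile)
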